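/- For a nonnegative integer $n$, let $L(n)$ be the number of two-colour (blue and green) partitions of $n$ in which all parts are distinct and odd parts may occur only in blue; here parts are distinct as coloured parts, so an even size may occur once in blue and once in green. Let $L_0(n)$ (resp. $L_1(n)$) be the number of partitions counted by $L(n)$ in which the number of blue even parts is even (resp. odd), and let $L_2(n)$ (resp. $L_3(n)$) be the number of partitions counted by $L(n)$ in which the number of blue parts is even (resp. odd). Then, for every nonnegative integer $n$, $$L_0(n)-L_1(n)=\begin{cases}1 & \text{if } n=\tfrac{k(k+1)}{2}\text{ for some integer } k\ge 0,\\ 0&\text{otherwise,}\end{cases}$$ $$L_2(n)-L_3(n)=\begin{cases}(-1)^n & \text{if } n=\tfrac{k(k+1)}{2}\text{ for some integer } k\ge 0,\\ 0&\text{otherwise.}\end{cases}$$ -/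

import Mathlib

/-- The two colours. -/
inductive PartColor where
  | blue : PartColor
  | green : PartColor
  deriving DecidableEq

instance PartColor.instFintype : Fintype PartColor :=
  ⟨{PartColor.blue, PartColor.green}, fun x => by cases x <;> simp⟩

/-- A two-colour partition of `n`: a finite multiset of coloured positive integers (a part is a
pair `(size, colour)`) whose sizes add up to `n`. The same size may occur in both colours. -/
@[ext]
structure TwoColorPartition (n : ℕ) where
  parts : Multiset (ℕ × PartColor)
  parts_pos : ∀ x ∈ parts, 0 < x.1
  parts_sum : (parts.map Prod.fst).sum = n

/-- There are only finitely many two-colour partitions of `n`, so the counts below are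
genuine cardinalities. -/
instance TwoColorPartition.instFinite (n : ℕ) : Finite (TwoColorPartition n) := by
  classical
  have hcard : ∀ p : TwoColorPartition n, p.parts.card ≤ n := by
    intro p
    have h := Multiset.card_nsmul_le_sum (s := p.parts.map Prod.fst) (a := 1) (by
      intro x hx
      obtain ⟨y, hy, rfl⟩ := Multiset.mem_map.1 hx
      exact p.parts_pos y hy)
    simpa [p.parts_sum] using h
  have hle : ∀ p : TwoColorPartition n, ∀ x ∈ p.parts, x.1 ≤ n := by
    intro p x hx
    have h := Multiset.le_sum_of_mem (Multiset.mem_map_of_mem Prod.fst hx)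
    rwa [p.parts_sum] at h
  let f : TwoColorPartition n → (Fin (n + 1) × PartColor → Fin (n + 1)) := fun p x =>
    ⟨p.parts.count (x.1.1, x.2),
      Nat.lt_succ_of_le ((Multiset.count_le_card _ _).trans (hcard p))⟩
  refine Finite.of_injective f ?_
  intro p q h
  ext1
  refine Multiset.ext.2 ?_
  rintro ⟨a, c⟩
  by_cases ha : a ≤ n
  · exact congrArg Fin.val (congrFun h (⟨a, Nat.lt_succ_of_le ha⟩, c))
  · rw [Multiset.count_eq_zero_of_notMem fun hp => ha (hle p _ hp),
      Multiset.count_eq_zero_of_notMem fun hq => ha (hle q _ hq)]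

/-- The number of blue parts. -/
def TwoColorPartition.numBlue {n : ℕ} (p : TwoColorPartition n) : ℕ :=
  (p.parts.filter fun x => x.2 = PartColor.blue).card

/-- The number of blue even parts. -/
def TwoColorPartition.numBlueEven {n : ℕ} (p : TwoColorPartition n) : ℕ :=
  (p.parts.filter fun x => x.2 = PartColor.blue ∧ Even x.1).card

/-- The two-colour partitions of `n` in which all (coloured) parts are distinct and the odd
parts occur only in blue. -/
def distinctOddBlue (n : ℕ) : Set (TwoColorPartition n) :=
  {p | p.parts.Nodup ∧ ∀ x ∈ p.parts, Odd x.1 → x.2 = PartColor.blue}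

/-- Number of partitions in `distinctOddBlue n`. -/
noncomputable def countL (n : ℕ) : ℕ := (distinctOddBlue n).ncard

/-- Those with an even number of blue even parts. -/
noncomputable def countL0 (n : ℕ) : ℕ := {p ∈ distinctOddBlue n | Even p.numBlueEven}.ncard

/-- Those with an odd number of blue even parts. -/
noncomputable def countL1 (n : ℕ) : ℕ := {p ∈ distinctOddBlue n | Odd p.numBlueEven}.ncard

/-- Those with an even number of blue parts. -/
noncomputable def countL2 (n : ℕ) : ℕ := {p ∈ distinctOddBlue n | Even p.numBlue}.ncard

/-- Those with an odd number of blue parts. -/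
noncomputable def countL3 (n : ℕ) : ℕ := {p ∈ distinctOddBlue n | Odd p.numBlue}.ncard

/-- `n` is a triangular number `0, 1, 3, 6, 10, …`; the division is exact. -/
def IsTriangular (n : ℕ) : Prop := ∃ k : ℕ, n = k * (k + 1) / 2

noncomputable instance IsTriangular.instDecidablePred : DecidablePred IsTriangular :=
  Classical.decPred _

/-! Weighting blue even parts by -1, the generating function of `L₀ - L₁` is `∏ (1 - q^(2k)) (1 +
q^k)`: blue even parts give the first factors, blue odd and green even parts together the second. By
Euler, `∏ (1 + q^k) = ∏ 1 / (1 - q^(2k-1))`, so Gauss's identity turns the product into `∑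
q^(k(k+1)/2)`. Everything is done with polynomials modulo a power of `X`. The second identity
follows by parity: all odd parts are blue, so the numbers of blue and of blue even parts differ by a
number congruent to `n` mod 2. -/

/-- A finite form of Gauss's identity for triangular numbers, due to Shanks. -/
theorem prod_mul_sum_pow_triangle {R : Type*} [CommRing R] (x : R) (n : ℕ) :
    (∏ k ∈ Finset.range n, (1 - x ^ (2 * k + 1))) *
        ∑ j ∈ Finset.range (2 * n), x ^ (j * (j + 1) / 2) =
      ∑ s ∈ Finset.range n, (∏ k ∈ Finset.Ico s n, (1 - x ^ (2 * k + 2))) *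
        (∏ k ∈ Finset.range s, (1 - x ^ (2 * k + 1))) * x ^ (s * (2 * n + 1)) := by
  induction n with
  | zero => simp
  | succ n ih =>
    set B : ℕ → R := fun s => ∏ k ∈ Finset.range s, (1 - x ^ (2 * k + 1)) with hB
    set Q : ℕ → ℕ → R := fun s n => ∏ k ∈ Finset.Ico s n, (1 - x ^ (2 * k + 2)) with hQ
    have hBs : ∀ s, B (s + 1) = B s * (1 - x ^ (2 * s + 1)) := fun s => Finset.prod_range_succ _ _
    -- Telescoping certificate: `t 0 = 0`, and `t n` with the new term `s = n` yields the two new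
    -- triangular powers.
    let t : ℕ → R := fun s => x ^ (s * (2 * n + 1)) * (1 - x ^ (2 * s)) * Q s n * B s
    have hstep : ∀ s ∈ Finset.range n,
        Q s (n + 1) * B s * x ^ (s * (2 * (n + 1) + 1)) =
          (1 - x ^ (2 * n + 1)) * (Q s n * B s * x ^ (s * (2 * n + 1))) +
            (t (s + 1) - t s) := by
      intro s hs
      have hsn := Finset.mem_range.1 hs
      have h1 : Q s (n + 1) = Q s n * (1 - x ^ (2 * n + 2)) :=
        Finset.prod_Ico_succ_top hsn.le _
      have h2 : Q s n = (1 - x ^ (2 * s + 2)) * Q (s + 1) n :=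
        Finset.prod_eq_prod_Ico_succ_bot hsn _
      simp only [t]
      rw [h1, hBs, h2]
      ring
    have hT1 : 2 * n * (2 * n + 1) / 2 = n * (2 * n + 1) := by
      rw [mul_assoc, Nat.mul_div_cancel_left _ two_pos]
    have hT2 : (2 * n + 1) * (2 * n + 1 + 1) / 2 = (n + 1) * (2 * n + 1) := by
      rw [show (2 * n + 1) * (2 * n + 1 + 1) = 2 * ((n + 1) * (2 * n + 1)) by ring,
        Nat.mul_div_cancel_left _ two_pos]
    have hQ1 : Q n (n + 1) = 1 - x ^ (2 * n + 2) := by simp [hQ]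
    have hQ0 : Q n n = 1 := by simp [hQ]
    have ih' : B n * ∑ j ∈ Finset.range (2 * n), x ^ (j * (j + 1) / 2) =
      ∑ s ∈ Finset.range n, Q s n * B s * x ^ (s * (2 * n + 1)) := ih
    change B (n + 1) * _ = ∑ s ∈ Finset.range (n + 1),
      Q s (n + 1) * B s * x ^ (s * (2 * (n + 1) + 1))
    rw [Finset.sum_range_succ, Finset.sum_congr rfl hstep, Finset.sum_add_distrib,
      ← Finset.mul_sum, ← ih', Finset.sum_range_sub, show 2 * (n + 1) = 2 * n + 1 + 1 by ring,
      Finset.sum_range_succ, Finset.sum_range_succ, hT1, hT2, hBs, hQ1]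
    simp only [t, hQ0]
    ring

/-- Euler's factorization of `(x²; x²)_{2n}`. -/
theorem prod_even_mul_prod_odd_mul_prod_one_add {R : Type*} [CommRing R] (x : R) (n : ℕ) :
    (∏ k ∈ Finset.range n, (1 - x ^ (2 * k + 2))) *
        ((∏ k ∈ Finset.range n, (1 - x ^ (2 * k + 1))) *
          ∏ k ∈ Finset.range (2 * n), (1 + x ^ (k + 1))) =
      ∏ k ∈ Finset.range (2 * n), (1 - x ^ (2 * k + 2)) := by
  induction n with
  | zero => simp
  | succ n ih =>
    rw [show 2 * (n + 1) = 2 * n + 1 + 1 by ring]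
    simp only [Finset.prod_range_succ]
    rw [← ih]
    ring

theorem dvd_prod_sub_one {R ι : Type*} [CommRing R] (d : R) (s : Finset ι) (f : ι → R)
    (h : ∀ i ∈ s, d ∣ f i - 1) : d ∣ ∏ i ∈ s, f i - 1 := by
  classical
  induction s using Finset.induction_on with
  | empty => simp
  | insert a s ha ih =>
    rw [Finset.prod_insert ha]
    have h1 := h a (Finset.mem_insert_self _ _)
    have h2 := ih fun i hi => h i (Finset.mem_insert_of_mem hi)
    have : f a * ∏ i ∈ s, f i - 1 = (f a - 1) * ∏ i ∈ s, f i + (∏ i ∈ s, f i - 1) := by ring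
    rw [this]
    exact dvd_add (h1.mul_right _) h2

open Polynomial in
/-- Gauss's identity for triangular numbers, as a congruence between polynomials. -/
theorem X_pow_dvd_prod_sub_sum_triangle (n : ℕ) (hn : 0 < n) :
    (X : ℤ[X]) ^ (2 * n + 1) ∣
      (∏ k ∈ Finset.range n, (1 - X ^ (2 * k + 2))) *
          ∏ k ∈ Finset.range (2 * n), (1 + X ^ (k + 1)) -
        ∑ j ∈ Finset.range (2 * n), X ^ (j * (j + 1) / 2) := by
  set A : ℤ[X] := ∏ k ∈ Finset.range n, (1 - X ^ (2 * k + 2)) with hA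
  set B : ℤ[X] := ∏ k ∈ Finset.range n, (1 - X ^ (2 * k + 1)) with hB
  set E : ℤ[X] := ∏ k ∈ Finset.range (2 * n), (1 + X ^ (k + 1)) with hE
  set S : ℤ[X] := ∑ j ∈ Finset.range (2 * n), X ^ (j * (j + 1) / 2) with hS
  have hAne : A ≠ 0 := by
    intro h
    have := congrArg (Polynomial.eval 0) h
    simp [hA, Polynomial.eval_prod] at this
  -- Cancelling `A` in Euler's factorization leaves only factors that are 1 modulo `X ^ (2 * n +
  -- 1)`.
  have hBE : B * E = ∏ k ∈ Finset.Ico n (2 * n), (1 - X ^ (2 * k + 2)) := by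
    apply mul_left_cancel₀ hAne
    rw [prod_even_mul_prod_odd_mul_prod_one_add, hA,
      Finset.prod_range_mul_prod_Ico _ (by omega)]
  have h1 : (X : ℤ[X]) ^ (2 * n + 1) ∣ B * E - 1 := by
    rw [hBE]
    refine dvd_prod_sub_one _ _ _ fun k hk => ?_
    rw [sub_sub_cancel_left, dvd_neg]
    exact pow_dvd_pow _ (by have := (Finset.mem_Ico.1 hk).1; omega)
  -- In Shanks's sum only `s = 0` survives the modulus, and that term is `A`.
  have h2 : (X : ℤ[X]) ^ (2 * n + 1) ∣ B * S - A := by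
    obtain ⟨m, rfl⟩ : ∃ m, n = m + 1 := ⟨n - 1, by omega⟩
    rw [hB, hS, prod_mul_sum_pow_triangle, Finset.sum_range_succ', hA]
    simp only [Finset.range_zero, Finset.prod_empty, zero_mul, pow_zero, mul_one,
      ← Finset.range_eq_Ico, add_sub_cancel_right]
    refine Finset.dvd_sum fun s _ => Dvd.dvd.mul_left (pow_dvd_pow _ ?_) _
    exact Nat.le_mul_of_pos_left _ s.succ_pos
  -- Both congruences combine without inverting `B`.
  have : A * E - S = (B * E - 1) * S - (B * S - A) * E := by ring
  rw [this]
  exact dvd_sub (h1.mul_right _) (h2.mul_right _)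

open Polynomial in
theorem coeff_sum_triangle (n m : ℕ) (hm : n < m) :
    (∑ j ∈ Finset.range m, (X : ℤ[X]) ^ (j * (j + 1) / 2)).coeff n =
      if IsTriangular n then 1 else 0 := by
  have hT : ∀ j : ℕ, 2 * (j * (j + 1) / 2) = j * (j + 1) := fun j =>
    Nat.mul_div_cancel' (Nat.even_mul_succ_self j).two_dvd
  simp only [Polynomial.finsetSum_coeff, Polynomial.coeff_X_pow]
  split_ifs with h
  · obtain ⟨k, hk⟩ := h
    rw [Finset.sum_eq_single k]
    · simp [hk]
    · intro j _ hjk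
      rw [if_neg]
      intro h
      apply hjk
      have h1 := hT j
      have h2 := hT k
      rw [← hk] at h2
      rw [← h] at h1
      rcases lt_trichotomy j k with h3 | h3 | h3
      · nlinarith
      · exact h3
      · nlinarith
    · intro hk'
      have h2 := hT k
      rw [← hk] at h2
      have : m ≤ k := by simpa using hk'
      nlinarith
  · refine Finset.sum_eq_zero fun j _ => if_neg fun hj => h ⟨j, hj⟩

/-! ### Generating function of the signed count -/

/-- The coloured parts of size at most `m` in which odd sizes are blue. -/
def admissibleParts (m : ℕ) : Finset (ℕ × PartColor) :=
  (Finset.Icc 1 m ×ˢ Finset.univ).filter fun x => Odd x.1 → x.2 = PartColor.blue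

/-- The sign of a coloured part: `-1` exactly for the blue even parts. -/
def blueEvenSign (x : ℕ × PartColor) : ℤ :=
  if x.2 = PartColor.blue ∧ Even x.1 then -1 else 1

theorem PartColor.prod_univ {M : Type*} [CommMonoid M] (f : PartColor → M) :
    ∏ c, f c = f PartColor.blue * f PartColor.green := by
  rw [show (Finset.univ : Finset PartColor) = {PartColor.blue, PartColor.green} from rfl,
    Finset.prod_pair (by decide)]

open Polynomial in
theorem prod_admissibleParts (n : ℕ) :
    ∏ x ∈ admissibleParts (2 * n), (1 + C (blueEvenSign x) * X ^ x.1) =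
      (∏ k ∈ Finset.range n, (1 - X ^ (2 * k + 2))) *
          ∏ k ∈ Finset.range (2 * n), (1 + X ^ (k + 1) : ℤ[X]) := by
  rw [admissibleParts, Finset.prod_filter, Finset.prod_product]
  simp only [PartColor.prod_univ]
  rw [← Finset.Ico_add_one_right_eq_Icc, Finset.prod_Ico_eq_prod_range, Nat.add_sub_cancel]
  induction n with
  | zero => simp
  | succ n ih =>
    rw [show 2 * (n + 1) = 2 * n + 1 + 1 by ring]
    simp only [Finset.prod_range_succ]
    rw [ih]
    have h1 : Odd (1 + 2 * n) := ⟨n, by ring⟩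
    have h2 : Even (1 + (2 * n + 1)) := ⟨n + 1, by ring⟩
    simp [blueEvenSign, h1, h2, Nat.not_even_iff_odd.2 h1, Nat.not_odd_iff_even.2 h2]
    ring

/-- Distinctness makes the multiset of parts a finset; no part exceeds `n`, so any bound `m ≥ n`
gives the same count. -/
theorem ncard_distinctOddBlue_filter (n m : ℕ) (hm : n ≤ m)
    (P : Multiset (ℕ × PartColor) → Prop) [DecidablePred P] :
    {p ∈ distinctOddBlue n | P p.parts}.ncard =
      (((admissibleParts m).powerset.filter fun S => ∑ x ∈ S, x.1 = n).filter
        fun S => P S.val).card := by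
  have hinj : Function.Injective (TwoColorPartition.parts (n := n)) :=
    fun p q h => TwoColorPartition.ext h
  rw [← Set.ncard_image_of_injective _ hinj, ← Set.ncard_coe_finset,
    ← Set.ncard_image_of_injective _ Finset.val_injective]
  congr 1
  ext s
  simp only [Set.mem_image, Set.mem_ofPred_eq, Finset.coe_filter, Finset.mem_filter,
    Finset.mem_powerset, distinctOddBlue]
  constructor
  · rintro ⟨p, ⟨⟨hnd, hodd⟩, hP⟩, rfl⟩
    refine ⟨⟨p.parts, hnd⟩, ⟨⟨fun x hx => ?_, p.parts_sum⟩, hP⟩, rfl⟩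
    have hx : x ∈ p.parts := hx
    have hle := Multiset.le_sum_of_mem (Multiset.mem_map_of_mem Prod.fst hx)
    rw [p.parts_sum] at hle
    simp only [admissibleParts, Finset.mem_filter, Finset.mem_product, Finset.mem_Icc,
      Finset.mem_univ, and_true]
    exact ⟨⟨p.parts_pos x hx, hle.trans hm⟩, hodd x hx⟩
  · rintro ⟨S, ⟨⟨hS, hsum⟩, hP⟩, rfl⟩
    have hS' : ∀ x ∈ S, (1 ≤ x.1 ∧ x.1 ≤ m) ∧ (Odd x.1 → x.2 = PartColor.blue) := by
      intro x hx
      simpa [admissibleParts] using hS hx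
    exact ⟨⟨S.val, fun x hx => (hS' x hx).1.1, hsum⟩,
      ⟨⟨S.nodup, fun x hx => (hS' x hx).2⟩, hP⟩, rfl⟩

theorem prod_blueEvenSign (S : Finset (ℕ × PartColor)) :
    ∏ x ∈ S, blueEvenSign x =
      (-1) ^ (S.val.filter fun x => x.2 = PartColor.blue ∧ Even x.1).card := by
  simp only [blueEvenSign]
  rw [Finset.prod_ite, Finset.prod_const, Finset.prod_const_one, mul_one]
  rfl

theorem sum_neg_one_pow {ι : Type*} (s : Finset ι) (f : ι → ℕ) :
    ∑ i ∈ s, (-1 : ℤ) ^ f i =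
      (s.filter fun i => Even (f i)).card - (s.filter fun i => Odd (f i)).card := by
  rw [← Finset.sum_filter_add_sum_filter_not s (fun i => Even (f i))]
  simp only [Nat.not_even_iff_odd]
  rw [Finset.sum_congr rfl fun i hi => (Finset.mem_filter.1 hi).2.neg_one_pow,
    Finset.sum_congr (s₁ := s.filter fun i => Odd (f i)) rfl
      fun i hi => (Finset.mem_filter.1 hi).2.neg_one_pow]
  simp
  ring

open Polynomial in
theorem countL0_sub_countL1_eq_coeff (n m : ℕ) (hm : n ≤ m) :
    (countL0 n : ℤ) - countL1 n =
      (∏ x ∈ admissibleParts m, (1 + C (blueEvenSign x) * X ^ x.1)).coeff n := by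
  have h0 := ncard_distinctOddBlue_filter n m hm
    fun s => Even (s.filter fun x => x.2 = PartColor.blue ∧ Even x.1).card
  have h1 := ncard_distinctOddBlue_filter n m hm
    fun s => Odd (s.filter fun x => x.2 = PartColor.blue ∧ Even x.1).card
  change countL0 n = _ at h0
  change countL1 n = _ at h1
  -- Expanding the product over subsets, each subset contributes its sign times `X` to its total
  -- size.
  rw [h0, h1, ← sum_neg_one_pow, Finset.prod_one_add, Polynomial.finsetSum_coeff,
    Finset.sum_filter]
  refine Finset.sum_congr rfl fun S _ => ?_
  rw [Finset.prod_mul_distrib, ← map_prod, Finset.prod_pow_eq_pow_sum, Polynomial.coeff_C_mul,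
    Polynomial.coeff_X_pow, prod_blueEvenSign]
  simp [eq_comm]

theorem countL0_sub_countL1 (n : ℕ) :
    (countL0 n : ℤ) - countL1 n = if IsTriangular n then 1 else 0 := by
  rw [countL0_sub_countL1_eq_coeff n (2 * (n + 1)) (by omega), prod_admissibleParts,
    ← coeff_sum_triangle n (2 * (n + 1)) (by omega), ← sub_eq_zero, ← Polynomial.coeff_sub]
  exact Polynomial.X_pow_dvd_iff.1 (X_pow_dvd_prod_sub_sum_triangle (n + 1) n.succ_pos) n
    (by omega)

/-- The blue parts are the blue even parts and all odd parts, and the number of odd parts has the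
parity of the sum. -/
theorem even_card_blue_iff (s : Multiset (ℕ × PartColor))
    (h : ∀ x ∈ s, Odd x.1 → x.2 = PartColor.blue) :
    Even (s.filter fun x => x.2 = PartColor.blue).card ↔
      (Even (s.filter fun x => x.2 = PartColor.blue ∧ Even x.1).card ↔
        Even (s.map Prod.fst).sum) := by
  induction s using Multiset.induction_on with
  | empty => simp
  | cons a s ih =>
    have ih := ih fun x hx => h x (Multiset.mem_cons_of_mem hx)
    have ha := h a (Multiset.mem_cons_self a s)
    have he := Nat.not_even_iff_odd (n := a.1)
    by_cases hb : a.2 = PartColor.blue <;> by_cases hae : Even a.1 <;>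
      simp only [Multiset.filter_cons, hb, hae, Multiset.card_add, Multiset.map_cons,
        Multiset.sum_cons, Nat.even_add, and_self, and_true, and_false, if_true, if_false,
        Multiset.card_singleton, Multiset.card_zero, Nat.not_even_one, Even.zero] at ih ⊢ <;>
      tauto

theorem TwoColorPartition.even_numBlue_iff {n : ℕ} (p : TwoColorPartition n)
    (hp : p ∈ distinctOddBlue n) : Even p.numBlue ↔ (Even p.numBlueEven ↔ Even n) := by
  have := even_card_blue_iff p.parts hp.2
  rwa [p.parts_sum] at this

theorem countL2_sub_countL3 (n : ℕ) :
    (countL2 n : ℤ) - countL3 n = (-1) ^ n * ((countL0 n : ℤ) - countL1 n) := by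
  rcases Nat.even_or_odd n with hn | hn
  · have h2 : countL2 n = countL0 n := congrArg Set.ncard <| Set.ext fun p =>
      and_congr_right fun hp => by simp [p.even_numBlue_iff hp, hn]
    have h3 : countL3 n = countL1 n := congrArg Set.ncard <| Set.ext fun p =>
      and_congr_right fun hp => by
        simp [← Nat.not_even_iff_odd, p.even_numBlue_iff hp, hn]
    rw [h2, h3, hn.neg_one_pow, one_mul]
  · have hn' := Nat.not_even_iff_odd.2 hn
    have h2 : countL2 n = countL1 n := congrArg Set.ncard <| Set.ext fun p =>
      and_congr_right fun hp => by
        simp [← Nat.not_even_iff_odd, p.even_numBlue_iff hp, hn']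
    have h3 : countL3 n = countL0 n := congrArg Set.ncard <| Set.ext fun p =>
      and_congr_right fun hp => by
        simp [← Nat.not_even_iff_odd, p.even_numBlue_iff hp, hn']
    rw [h2, h3, hn.neg_one_pow]
    ring

theorem theorem1p7 (n : ℕ) :
    (countL0 n : ℤ) - (countL1 n : ℤ) = (if IsTriangular n then 1 else 0) ∧
    (countL2 n : ℤ) - (countL3 n : ℤ) = (if IsTriangular n then (-1) ^ n else 0) := by
  refine ⟨countL0_sub_countL1 n, ?_⟩
  rw [countL2_sub_countL3, countL0_sub_countL1]
  split_ifs <;> simp
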